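/- For $k\ge 1$ let the approximate index function be the partial function $$\mathsf{ApInd}_k:\{0,1\}^k\times\{0,1,2\}^{2^k}\to\{0,1,*\}$$ defined as follows ($\log$ is to base $2$). For an address $a\in\{0,1\}^k$ and a table $x=(x_b)_{b\in\{0,1\}^k}$, $\mathsf{ApInd}_k(a,x)=x_a$ if $x_a\in\{0,1\}$, $x_b=x_a$ for every $b$ at Hamming distance at most $\frac k2-\sqrt{k\log k}$ from $a$, and $x_b=2$ for every other $b$; in all other cases $\mathsf{ApInd}_k(a,x)=*$ (undefined). An input has $k+2^k$ positions (those of the address and those of the table). For a partial function $f$ with values in $\{0,1,*\}$ on strings with finite position set $I$, the public coin certificate game complexity is $$\mathsf{CG}^{\mathrm{pub}}(f)=\min_p\ \max_{x\in f^{-1}(0),\,y\in f^{-1}(1)}\ \frac1{\Pr_{(A,B)\sim p}\left[A(x)=B(y)=i\text{ for some } i \text{ with } x_i\ne y_i\right]},$$ where $p$ ranges over the probability distributions on pairs $(A,B)$ of deterministic strategies, i.e. maps from inputs to $I$. Let $\mathsf R(f)$ be the randomized query complexity of $f$: the least $d$ for which some probability distribution on deterministic decision trees, each making at most $d$ queries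 (a query reveals the symbol at one position) on every input, outputs $f(x)$ with probability at least $2/3$ for every $x\in f^{-1}(0)\cup f^{-1}(1)$. **Theorem.** As $k\to\infty$, $$\mathsf{CG}^{\mathrm{pub}}(\mathsf{ApInd}_k)=O(\log k)\qquad\text{and}\qquad \mathsf R(\mathsf{ApInd}_k)=\Theta\left(\sqrt{k\log k}\right).$$ Consequently $\mathsf{CG}^{\mathrm{pub}}(\mathsf{ApInd}_k)=O(\log \mathsf R(\mathsf{ApInd}_k))$, an exponential separation between $\mathsf R$ and $\mathsf{CG}^{\mathrm{pub}}$ for partial functions. -/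

import Mathlib

open Filter Asymptotics
open scoped ENNReal

/-! ### Partial Boolean-valued functions on strings

An input is a string `x : ∀ i : ι, α i`, with positions `ι` and the symbol at position `i` taken from
the alphabet `α i`.  A partial Boolean-valued function is `f : (∀ i, α i) → Option Bool`, where
`f x = none` means that `f` is undefined at `x`. -/

section CertificateGame

variable {ι : Type} {α : ι → Type}

/-- A pair `(A, B)` of deterministic strategies, each mapping an input to an output position. -/
abbrev StrategyPair (ι : Type) (α : ι → Type) : Type :=
  ((∀ i, α i) → ι) × ((∀ i, α i) → ι)

/-- `(A, B)` is correct on `x, y` if both players output the same position `i`, and `x i ≠ y i`. -/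
def StrategyPair.Correct (S : StrategyPair ι α) (x y : ∀ i, α i) : Prop :=
  ∃ i, S.1 x = i ∧ S.2 y = i ∧ x i ≠ y i

/-- The probability that a public coin strategy (a probability distribution `p` on pairs of
deterministic strategies) is correct on `x, y`. -/
noncomputable def winProb (p : PMF (StrategyPair ι α)) (x y : ∀ i, α i) : ℝ≥0∞ :=
  p.toOuterMeasure {S | S.Correct x y}

/-- Public coin certificate game complexity: the infimum over public coin strategies of the
supremum over `x ∈ f⁻¹(0)`, `y ∈ f⁻¹(1)` of the inverse winning probability (`1 / 0 = ∞`). -/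
noncomputable def CGpub (f : (∀ i, α i) → Option Bool) : ℝ≥0∞ :=
  ⨅ p : PMF (StrategyPair ι α),
    ⨆ (x : ∀ i, α i) (y : ∀ i, α i) (_ : f x = some false) (_ : f y = some true),
      (winProb p x y)⁻¹

end CertificateGame

/-! ### Randomized query complexity -/

/-- Deterministic decision trees: an inner node queries a position and branches on the symbol
found there; a leaf carries the output. -/
inductive DecisionTree (ι : Type) (α : ι → Type) : Type
  | leaf (output : Bool) : DecisionTree ι α
  | query (i : ι) (next : α i → DecisionTree ι α) : DecisionTree ι α

namespace DecisionTree

variable {ι : Type} {α : ι → Type}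

/-- The output of a decision tree on input `x`. -/
def eval (x : ∀ i, α i) : DecisionTree ι α → Bool
  | leaf b => b
  | query i next => (next (x i)).eval x

/-- The number of queries a decision tree makes on input `x`. -/
def numQueries (x : ∀ i, α i) : DecisionTree ι α → ℕ
  | leaf _ => 0
  | query i next => (next (x i)).numQueries x + 1

end DecisionTree

/-- A randomized decision tree (a distribution `P` on decision trees) computes the partial function
`f` with `d` queries if every tree in its support makes at most `d` queries on each input, and on
each input where `f` is defined the output equals the value of `f` with probability at least
`2 / 3`. -/
def ComputesWithQueries {ι : Type} {α : ι → Type} (P : PMF (DecisionTree ι α))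
    (f : (∀ i, α i) → Option Bool) (d : ℕ) : Prop :=
  (∀ T ∈ P.support, ∀ x, T.numQueries x ≤ d) ∧
    ∀ x b, f x = some b → 2 / 3 ≤ P.toOuterMeasure {T | T.eval x = b}

/-- Randomized query complexity: the least number of queries that suffices. -/
noncomputable def randQueryComplexity {ι : Type} {α : ι → Type}
    (f : (∀ i, α i) → Option Bool) : ℕ :=
  sInf {d | ∃ P : PMF (DecisionTree ι α), ComputesWithQueries P f d}

/-! ### The approximate index function -/

namespace ApInd

/-- Positions of an input: `k` address positions and `2 ^ k` table positions, the latter labelled by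
`k`-bit strings. -/
abbrev Pos (k : ℕ) : Type := Fin k ⊕ (Fin k → Bool)

/-- The alphabet is `{0, 1}` at address positions and `{0, 1, 2}` at table positions. -/
abbrev Symbol (k : ℕ) : Pos k → Type
  | Sum.inl _ => Bool
  | Sum.inr _ => Fin 3

/-- Inputs: elements of `{0, 1} ^ k × {0, 1, 2} ^ (2 ^ k)`. -/
abbrev Input (k : ℕ) : Type := ∀ i : Pos k, Symbol k i

/-- The address part of an input. -/
def address {k : ℕ} (x : Input k) : Fin k → Bool := fun j => x (Sum.inl j)

/-- The table part of an input. -/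
def table {k : ℕ} (x : Input k) : (Fin k → Bool) → Fin 3 := fun b => x (Sum.inr b)

/-- The radius `k / 2 - √(k log k)`, with the binary logarithm. -/
noncomputable def radius (k : ℕ) : ℝ := (k : ℝ) / 2 - √((k : ℝ) * Real.logb 2 k)

/-- With `a` the address, the table holds one and the same bit at all labels within Hamming
distance `radius k` of `a`, this bit being the entry at `a`, and it holds `2` at all other labels. -/
def Valid {k : ℕ} (x : Input k) : Prop :=
  (table x (address x) = 0 ∨ table x (address x) = 1) ∧
    ∀ b : Fin k → Bool,
      ((hammingDist b (address x) : ℝ) ≤ radius k → table x b = table x (address x)) ∧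
      (radius k < (hammingDist b (address x) : ℝ) → table x b = 2)

end ApInd

open Classical in
/-- The approximate index function: the table entry at the address if the input is valid, and
undefined otherwise. -/
noncomputable def ApInd (k : ℕ) (x : ApInd.Input k) : Option Bool :=
  if ApInd.Valid x then some (decide (ApInd.table x (ApInd.address x) = 1)) else none

/-! Write s = √(k log k), with log to base 2. Query complexity, upper bound: read about 2s address
bits and fill the others with all zeros or with all ones. The distances of these two labels from the
address add up to at most k − 2s, twice the radius, so one label lies in the ball and shows the
value.

Query complexity, lower bound: draw the address and the value uniformly. Until a label in the ball
is probed, all probed table entries are 2 and the value stays hidden. Given the few address bits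
read so far, the address is uniform on a subcube, and by a Chernoff bound (`card_ball_le`) a fixed
label lies in its ball with probability at most 1/k. A union bound along the tree (`card_probes_le`)
shows that s/4 queries reach the ball with probability at most 1/4, which leaves success probability
at most 5/8 < 2/3.

Certificate game: the tables of a 0-input and a 1-input differ at every label in both balls. With
probability 1/2 both players name the same random address position, which is good enough when the
addresses are at distance more than k/(50 log k). Otherwise each samples a label from a product
distribution biased towards its own address, truncated to its ball. The bias is of order s/k: large
enough that nearly all mass lies in the ball, small enough that the distributions of close addresses
overlap by a constant (`card_region_inter_ge`). Min-wise sampling with a shared random order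
(`card_inter_mul_card_le`) turns the overlap into a constant probability of agreement. -/

/-! ### Decision trees -/

namespace DecisionTree

variable {ι : Type} {α : ι → Type}

/-- The set of positions queried on input `x`. -/
def queried (x : ∀ i, α i) : DecisionTree ι α → Set ι
  | leaf _ => ∅
  | query i next => insert i ((next (x i)).queried x)

theorem eval_eq_of_eqOn_queried {x y : ∀ i, α i} (T : DecisionTree ι α)
    (h : ∀ i ∈ T.queried x, x i = y i) : T.eval x = T.eval y := by
  induction T with
  | leaf b => rfl
  | query i next ih =>
    have hi : x i = y i := h i (Set.mem_insert _ _)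
    simp only [eval]
    rw [← hi]
    exact ih (x i) fun j hj => h j (Set.mem_insert_of_mem _ hj)

end DecisionTree

/-- The easy direction of Yao's principle for a uniform distribution on a finite family of inputs. -/
theorem two_mul_card_le_of_computesWithQueries {ι : Type} {α : ι → Type} {J : Type*} [Fintype J]
    {P : PMF (DecisionTree ι α)} {f : (∀ i, α i) → Option Bool} {d : ℕ}
    (hP : ComputesWithQueries P f d) (x : J → ∀ i, α i) (b : J → Bool)
    (hf : ∀ j, f (x j) = some (b j)) (c : ℕ)
    (hc : ∀ T ∈ P.support, (Finset.univ.filter fun j => T.eval (x j) = b j).card ≤ c) :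
    2 * Fintype.card J ≤ 3 * c := by
  classical
  have h1 : ∑ j : J, P.toOuterMeasure {T | T.eval (x j) = b j} ≤ c := by
    simp only [PMF.toOuterMeasure_apply]
    rw [← Summable.tsum_finsetSum (fun _ _ => ENNReal.summable)]
    calc _ ≤ ∑' T, P T * c := by
          refine ENNReal.tsum_le_tsum fun T => ?_
          by_cases hT : T ∈ P.support
          · simp only [Set.indicator_apply, Set.mem_ofPred_eq]
            rw [← Finset.sum_filter, Finset.sum_const, nsmul_eq_mul, mul_comm]
            gcongr
            exact_mod_cast hc T hT
          · have : P T = 0 := by simpa [PMF.mem_support_iff] using hT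
            simp [Set.indicator_apply, this]
      _ = c := by rw [ENNReal.tsum_mul_right, P.tsum_coe, one_mul]
  have h2 : (Fintype.card J : ℝ≥0∞) * (2 / 3) ≤ c := by
    refine le_trans ?_ h1
    rw [← nsmul_eq_mul, ← Finset.card_univ, ← Finset.sum_const]
    exact Finset.sum_le_sum fun j _ => hP.2 _ _ (hf j)
  have h3 : (2 * Fintype.card J : ℝ≥0∞) ≤ 3 * c := by
    calc (2 * Fintype.card J : ℝ≥0∞) = 3 * (Fintype.card J * (2 / 3)) := by
          rw [mul_left_comm, ENNReal.mul_div_cancel (by norm_num) (by norm_num), mul_comm]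
      _ ≤ 3 * c := by gcongr
  exact_mod_cast h3

/-! ### Sums over the Boolean cube -/

/-- Exponential moments of the distance factor over coordinates, which is what both Chernoff bounds
below rest on. -/
theorem exp_mul_hammingDist {κ : Type*} [Fintype κ] (t : ℝ) (a b : κ → Bool) :
    Real.exp (t * hammingDist a b) = ∏ i, if a i = b i then 1 else Real.exp t := by
  rw [Finset.prod_ite, Finset.prod_const_one, one_mul, Finset.prod_const, ← Real.exp_nat_mul,
    mul_comm, hammingDist]

theorem sum_prod_bool {κ : Type*} [Fintype κ] [DecidableEq κ] (f : κ → Bool → ℝ) :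
    ∑ b : κ → Bool, ∏ i, f i (b i) = ∏ i, (f i true + f i false) := by
  simp only [← Fintype.sum_bool]
  rw [Finset.prod_univ_sum, Fintype.piFinset_univ]

theorem sum_prod_ite_eq {κ : Type*} [Fintype κ] [DecidableEq κ] (a : κ → Bool) (u v : ℝ) :
    ∑ b : κ → Bool, ∏ i, (if a i = b i then u else v) = (u + v) ^ Fintype.card κ := by
  rw [sum_prod_bool fun i c => if a i = c then u else v, ← Finset.card_univ, ← Finset.prod_const]
  refine Finset.prod_congr rfl fun i _ => ?_
  cases a i <;> simp [add_comm]

namespace ApInd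

variable {k : ℕ}

theorem ApInd_eq_some_iff {x : Input k} {b : Bool} :
    ApInd k x = some b ↔ Valid x ∧ decide (table x (address x) = 1) = b := by
  classical
  unfold ApInd
  split_ifs with h <;> simp [h]

/-! ### The deterministic algorithm -/

/-- Read the address bits in `l`, overwrite the corresponding entries of `w`, and continue with
the tree `K w`. -/
def readAddress (K : (Fin k → Bool) → DecisionTree (Pos k) (Symbol k)) :
    List (Fin k) → (Fin k → Bool) → DecisionTree (Pos k) (Symbol k)
  | [], w => K w
  | i :: l, w => .query (Sum.inl i) fun s => readAddress K l (Function.update w i s)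

theorem readAddress_spec (K : (Fin k → Bool) → DecisionTree (Pos k) (Symbol k)) (x : Input k)
    (l : List (Fin k)) (w : Fin k → Bool) :
    (readAddress K l w).eval x = (K fun i => if i ∈ l then address x i else w i).eval x ∧
    (readAddress K l w).numQueries x =
      (K fun i => if i ∈ l then address x i else w i).numQueries x + l.length := by
  induction l generalizing w with
  | nil => simp [readAddress]
  | cons i l ih =>
    have key : (fun j => if j ∈ l then address x j else Function.update w i (x (Sum.inl i)) j) =
        fun j => if j ∈ i :: l then address x j else w j := by
      funext j
      by_cases hj : j ∈ l
      · simp [hj]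
      · by_cases hji : j = i
        · subst hji; simp [hj, address]
        · simp [hj, hji]
    obtain ⟨h1, h2⟩ := ih (Function.update w i (x (Sum.inl i)))
    rw [key] at h1 h2
    refine ⟨h1, ?_⟩
    simp only [readAddress, DecisionTree.numQueries, List.length_cons]
    rw [h2, add_assoc]

/-- Query the labels `w` and `w'` in turn and output the first bit found. -/
def probeTwo (w w' : Fin k → Bool) : DecisionTree (Pos k) (Symbol k) :=
  .query (Sum.inr w) fun s : Fin 3 =>
    if s = 2 then .query (Sum.inr w') fun s' : Fin 3 => .leaf (decide (s' = 1))
    else .leaf (decide (s = 1))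

theorem numQueries_probeTwo_le (x : Input k) (w w' : Fin k → Bool) :
    (probeTwo w w').numQueries x ≤ 2 := by
  simp only [probeTwo, DecisionTree.numQueries]
  split_ifs <;> simp [DecisionTree.numQueries]

theorem eval_probeTwo {x : Input k} (hx : Valid x) {w w' : Fin k → Bool}
    (h : (hammingDist w (address x) : ℝ) ≤ radius k ∨ (hammingDist w' (address x) : ℝ) ≤ radius k) :
    (probeTwo w w').eval x = decide (table x (address x) = 1) := by
  obtain ⟨h01, hb⟩ := hx
  have h2 : table x (address x) ≠ 2 := by
    rcases h01 with h | h <;> rw [h] <;> decide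
  simp only [probeTwo, DecisionTree.eval]
  change (DecisionTree.eval x (if table x w = 2 then _ else _)) = _
  split_ifs with hw
  · have hw' : ¬ (hammingDist w (address x) : ℝ) ≤ radius k := fun hle =>
      h2 (((hb w).1 hle).symm.trans hw)
    simp only [DecisionTree.eval]
    change decide (table x w' = 1) = _
    rw [(hb w').1 (h.resolve_left hw')]
  · have hw' : (hammingDist w (address x) : ℝ) ≤ radius k := by
      by_contra hlt
      exact hw ((hb w).2 (not_le.1 hlt))
    simp only [DecisionTree.eval]
    change decide (table x w = 1) = _
    rw [(hb w).1 hw']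

/-- Each coordinate outside `F` disagrees with `a` in exactly one of the two fillings, and no
coordinate of `F` does in either. -/
theorem hammingDist_add_hammingDist_not (a : Fin k → Bool) (F : Finset (Fin k)) :
    hammingDist (fun i => if i ∈ F then a i else false) a +
      hammingDist (fun i => if i ∈ F then a i else true) a = k - F.card := by
  simp only [hammingDist]
  rw [← Finset.card_union_of_disjoint]
  · have hc := Finset.card_compl F
    rw [Fintype.card_fin] at hc
    rw [← hc]
    congr 1
    ext i
    by_cases hi : i ∈ F <;> cases h : a i <;> simp [hi, h]
  · rw [Finset.disjoint_filter]
    intro i _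
    by_cases hi : i ∈ F <;> simp [hi]

/-- Reading the address bits in `F` and probing the two labels that agree with the address on `F`
and are constant outside `F`. -/
noncomputable def readAndProbe (F : Finset (Fin k)) : DecisionTree (Pos k) (Symbol k) :=
  readAddress (fun w => probeTwo w fun i => if i ∈ F.toList then w i else true) F.toList
    fun _ => false

theorem computesWithQueries_readAndProbe (F : Finset (Fin k))
    (hF : 2 * √((k : ℝ) * Real.logb 2 k) ≤ F.card) :
    ComputesWithQueries (PMF.pure (readAndProbe F)) (ApInd k) (F.card + 2) := by
  constructor
  · intro T hT x
    rw [PMF.mem_support_pure_iff] at hT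
    subst hT
    unfold readAndProbe
    rw [(readAddress_spec _ _ _ _).2, Finset.length_toList]
    have := numQueries_probeTwo_le x
    grind
  · intro x b hb
    obtain ⟨hx, hb⟩ := ApInd_eq_some_iff.1 hb
    have heval : (readAndProbe F).eval x = b := by
      unfold readAndProbe
      rw [(readAddress_spec _ _ _ _).1, ← hb]
      apply eval_probeTwo hx
      have key := hammingDist_add_hammingDist_not (address x) F
      have hk : F.card ≤ k := by simpa using F.card_le_univ
      have e : (fun i => if i ∈ F.toList then (if i ∈ F.toList then address x i else false)
          else true) = fun i => if i ∈ F then address x i else true := by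
        funext i; by_cases hi : i ∈ F <;> simp [hi]
      simp only [e]
      simp only [Finset.mem_toList]
      have key' : (hammingDist (fun i => if i ∈ F then address x i else false) (address x) : ℝ) +
          hammingDist (fun i => if i ∈ F then address x i else true) (address x) = k - F.card := by
        rw [← Nat.cast_sub hk, ← key]; push_cast; rfl
      unfold radius
      by_contra! hcon
      linarith [hcon.1, hcon.2]
    have : readAndProbe F ∈ {T : DecisionTree (Pos k) (Symbol k) | T.eval x = b} := heval
    rw [PMF.toOuterMeasure_pure_apply, if_pos this]
    refine ENNReal.div_le_of_le_mul ?_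
    norm_num

/-- The first conjunct says that the infimum is attained, so that the lower bound can be applied to
it; `sInf ∅ = 0` in ℕ would make it meaningless otherwise. -/
theorem randQueryComplexity_le (h : 2 * √((k : ℝ) * Real.logb 2 k) ≤ k) :
    (∃ P, ComputesWithQueries P (ApInd k) (randQueryComplexity (ApInd k))) ∧
      (randQueryComplexity (ApInd k) : ℝ) ≤ 2 * √((k : ℝ) * Real.logb 2 k) + 3 := by
  set m := ⌈2 * √((k : ℝ) * Real.logb 2 k)⌉₊ with hm
  have hmk : m ≤ k := Nat.ceil_le.2 h
  obtain ⟨F, -, hF⟩ := Finset.exists_subset_card_eq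
    (s := (Finset.univ : Finset (Fin k))) (n := m) (by simpa using hmk)
  have hc := computesWithQueries_readAndProbe F (by rw [hF]; exact Nat.le_ceil _)
  have hmem : m + 2 ∈ {d | ∃ P, ComputesWithQueries P (ApInd k) d} := ⟨_, hF ▸ hc⟩
  refine ⟨Nat.sInf_mem ⟨_, hmem⟩, ?_⟩
  have h1 : randQueryComplexity (ApInd k) ≤ m + 2 := Nat.sInf_le hmem
  have h2 : (m : ℝ) < 2 * √((k : ℝ) * Real.logb 2 k) + 1 := Nat.ceil_lt_add_one (by positivity)
  have h3 : (randQueryComplexity (ApInd k) : ℝ) ≤ m + 2 := by exact_mod_cast h1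
  linarith

end ApInd

/-! ### The lower bound for randomized query complexity -/

namespace ApInd

variable {k : ℕ}

/-- The input with address `a` and all table entries equal to `2`. -/
def blank (a : Fin k → Bool) : Input k
  | Sum.inl i => a i
  | Sum.inr _ => (2 : Fin 3)

open Classical in
/-- The valid input with address `a` and value `z`. -/
noncomputable def canonical (a : Fin k → Bool) (z : Bool) : Input k
  | Sum.inl i => a i
  | Sum.inr b => if (hammingDist b a : ℝ) ≤ radius k then (if z then (1 : Fin 3) else 0) else 2

theorem ApInd_canonical (hr : 0 ≤ radius k) (a : Fin k → Bool) (z : Bool) :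
    ApInd k (canonical a z) = some z := by
  have haddr : address (canonical a z) = a := rfl
  have htab : ∀ b, table (canonical a z) b =
      if (hammingDist b a : ℝ) ≤ radius k then (if z then (1 : Fin 3) else 0) else 2 := fun _ => rfl
  have hself : table (canonical a z) a = if z then (1 : Fin 3) else 0 := by
    rw [htab, if_pos (by simpa using hr)]
  rw [ApInd_eq_some_iff, Valid, haddr, hself]
  refine ⟨⟨by cases z <;> simp, fun b => ⟨fun h => ?_, fun h => ?_⟩⟩, by cases z <;> simp⟩
  · rw [htab, if_pos h]
  · rw [htab, if_neg (not_le.2 h)]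

/-- On the blank input with address `a`, the tree `T` queries a label within distance `r` of `a`. -/
def Probes (r : ℝ) (T : DecisionTree (Pos k) (Symbol k)) (a : Fin k → Bool) : Prop :=
  ∃ b, Sum.inr b ∈ T.queried (blank a) ∧ (hammingDist b a : ℝ) ≤ r

theorem eval_canonical_of_not_probes {T : DecisionTree (Pos k) (Symbol k)} {a : Fin k → Bool}
    (h : ¬ Probes (radius k) T a) (z : Bool) : T.eval (canonical a z) = T.eval (blank a) := by
  symm
  apply DecisionTree.eval_eq_of_eqOn_queried
  rintro (i | b) hi
  · rfl
  · have : ¬ (hammingDist b a : ℝ) ≤ radius k := fun hb => h ⟨b, hi, hb⟩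
    simp [blank, canonical, this]

/-- The coordinates that the subcube `piFinset t` restricts. -/
def restricted (t : Fin k → Finset Bool) : Finset (Fin k) :=
  Finset.univ.filter fun i => t i ≠ Finset.univ

theorem card_restricted_update_le (t : Fin k → Finset Bool) (i : Fin k) (u : Finset Bool) :
    (restricted (Function.update t i u)).card ≤ (restricted t).card + 1 := by
  refine le_trans (Finset.card_le_card fun j hj => ?_) (Finset.card_insert_le i (restricted t))
  by_cases hji : j = i
  · simp [hji]
  · rw [restricted, Finset.mem_filter, Function.update_of_ne hji] at hj
    exact Finset.mem_insert_of_mem (Finset.mem_filter.2 hj)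

theorem piFinset_update_inter (t : Fin k → Finset Bool) (i : Fin k) (s : Bool) :
    Fintype.piFinset (Function.update t i (t i ∩ {s})) =
      (Fintype.piFinset t).filter fun a => a i = s := by
  ext a
  simp only [Fintype.mem_piFinset, Finset.mem_filter]
  constructor
  · intro h
    have hi := h i
    simp only [Function.update_self, Finset.mem_inter, Finset.mem_singleton] at hi
    refine ⟨fun j => ?_, hi.2⟩
    by_cases hji : j = i
    · subst hji; exact hi.1
    · simpa [hji] using h j
  · rintro ⟨h, hs⟩ j
    by_cases hji : j = i
    · subst hji; simpa [hs] using h j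
    · simpa [hji] using h j

-- Induction on the tree, with the address confined to the subcube consistent with the answers so
-- far. An address query splits the subcube in two; a table query is answered by 2 and adds at most
-- a fraction `p` of bad addresses. `D` bounds how many coordinates are ever restricted, so `hball`
-- remains applicable.
open Classical in
theorem card_probes_le {r p : ℝ} (hp : 0 ≤ p) {D : ℕ}
    (hball : ∀ t : Fin k → Finset Bool, (restricted t).card ≤ D → ∀ b,
      (((Fintype.piFinset t).filter fun a => (hammingDist b a : ℝ) ≤ r).card : ℝ) ≤
        p * (Fintype.piFinset t).card)
    (T : DecisionTree (Pos k) (Symbol k)) (t : Fin k → Finset Bool) (n : ℕ)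
    (hD : (restricted t).card + n ≤ D)
    (hn : ∀ a ∈ Fintype.piFinset t, T.numQueries (blank a) ≤ n) :
    (((Fintype.piFinset t).filter fun a => Probes r T a).card : ℝ) ≤
      n * p * (Fintype.piFinset t).card := by
  induction T generalizing t n with
  | leaf c =>
    have : (Fintype.piFinset t).filter (fun a => Probes r (.leaf c) a) = ∅ := by
      simp [Probes, DecisionTree.queried]
    rw [this]
    simp only [Finset.card_empty, Nat.cast_zero]
    positivity
  | query q next ih =>
    rcases (Fintype.piFinset t).eq_empty_or_nonempty with h0 | ⟨a₀, ha₀⟩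
    · simp [h0]
    obtain ⟨m, rfl⟩ : ∃ m, n = m + 1 :=
      Nat.exists_eq_add_one.2 (lt_of_lt_of_le (Nat.succ_pos _) (hn a₀ ha₀))
    rcases q with i | b
    · have hfib : ∀ A : Finset (Fin k → Bool), A.card =
          (A.filter fun a => a i = true).card + (A.filter fun a => a i = false).card := by
        intro A
        rw [Finset.card_eq_sum_card_fiberwise (f := fun a => a i) (t := Finset.univ)
          (fun _ _ => Finset.mem_coe.2 (Finset.mem_univ _)), Fintype.sum_bool]
      have hs : ∀ s : Bool, ((((Fintype.piFinset t).filter fun a =>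
          Probes r (.query (Sum.inl i) next) a).filter fun a => a i = s).card : ℝ) ≤
          m * p * ((Fintype.piFinset t).filter fun a => a i = s).card := by
        intro s
        -- Intersecting with `t i` also covers a repeated query of position `i`: the contradictory
        -- branch gets an empty subcube.
        have h1 := ih s (Function.update t i (t i ∩ {s})) m
          (by have := card_restricted_update_le t i (t i ∩ {s}); omega)
          (by
            intro a ha
            rw [piFinset_update_inter, Finset.mem_filter] at ha
            have := hn a ha.1
            simp only [DecisionTree.numQueries, blank] at this
            rw [ha.2] at this
            omega)
        rw [piFinset_update_inter] at h1
        refine le_trans ?_ h1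
        norm_cast
        refine Finset.card_le_card fun a ha => ?_
        simp only [Finset.mem_filter] at ha ⊢
        refine ⟨⟨ha.1.1, ha.2⟩, ?_⟩
        obtain ⟨b, hb, hd⟩ := ha.1.2
        refine ⟨b, ?_, hd⟩
        simp only [DecisionTree.queried, blank] at hb
        rw [ha.2] at hb
        exact hb.resolve_left (by simp)
      rw [hfib ((Fintype.piFinset t).filter _), hfib (Fintype.piFinset t)]
      push_cast
      have h1 := hs true
      have h2 := hs false
      have h3 : 0 ≤ p * (((Fintype.piFinset t).filter fun a => a i = true).card +
        ((Fintype.piFinset t).filter fun a => a i = false).card : ℝ) :=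
        mul_nonneg hp (add_nonneg (Nat.cast_nonneg _) (Nat.cast_nonneg _))
      linarith
    · have h1 := ih (2 : Fin 3) t m (by omega) (by
        intro a ha
        have : (next (2 : Fin 3)).numQueries (blank a) + 1 ≤ m + 1 := hn a ha
        omega)
      have h2 := hball t (by omega) b
      have h3 : ((Fintype.piFinset t).filter fun a => Probes r (.query (Sum.inr b) next) a).card ≤
          ((Fintype.piFinset t).filter fun a => (hammingDist b a : ℝ) ≤ r).card +
          ((Fintype.piFinset t).filter fun a => Probes r (next (2 : Fin 3)) a).card := by
        refine le_trans (Finset.card_le_card fun a ha => ?_) (Finset.card_union_le _ _)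
        simp only [Finset.mem_filter, Finset.mem_union] at ha ⊢
        obtain ⟨hat, b', hb', hd⟩ := ha
        simp only [DecisionTree.queried, blank] at hb'
        rcases hb' with hb' | hb'
        · left
          rw [Sum.inr.inj hb'] at hd
          exact ⟨hat, hd⟩
        · exact Or.inr ⟨hat, b', hb', hd⟩
      have h4 : (((Fintype.piFinset t).filter fun a =>
          Probes r (.query (Sum.inr b) next) a).card : ℝ) ≤
          ((Fintype.piFinset t).filter fun a => (hammingDist b a : ℝ) ≤ r).card +
          ((Fintype.piFinset t).filter fun a => Probes r (next (2 : Fin 3)) a).card := by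
        exact_mod_cast h3
      push_cast
      linarith

/-- A Chernoff bound for Hamming balls in subcubes. -/
theorem card_ball_le (t : Fin k → Finset Bool) (b : Fin k → Bool) (r u : ℝ) (hu : 0 ≤ u) :
    (((Fintype.piFinset t).filter fun a => (hammingDist b a : ℝ) ≤ r).card : ℝ) ≤
      Real.exp (u * r + k * (u ^ 2 / 8 - u / 2) + (restricted t).card * (u / 2)) *
        (Fintype.piFinset t).card := by
  have hfac : ∀ i, ∑ c ∈ t i, (if b i = c then 1 else Real.exp (-u)) ≤
      (t i).card * (Real.exp (u ^ 2 / 8 - u / 2) *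
        if t i ≠ Finset.univ then Real.exp (u / 2) else 1) := by
    intro i
    by_cases hi : t i = Finset.univ
    · rw [hi, Fintype.sum_bool]
      -- A free coordinate contributes 1 + e^(-u) = 2 e^(-u/2) cosh(u/2). A restricted one is
      -- bounded trivially by 1 per element, and the factor e^(u/2) pays for the lost gain.
      have hc := Real.cosh_le_exp_half_sq (u / 2)
      rw [Real.cosh_eq] at hc
      have e1 : Real.exp (u ^ 2 / 8 - u / 2) = Real.exp ((u / 2) ^ 2 / 2) * Real.exp (-(u / 2)) := by
        rw [← Real.exp_add]; ring_nf
      have e2 : Real.exp (-u) = Real.exp (-(u / 2)) * Real.exp (-(u / 2)) := by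
        rw [← Real.exp_add]; ring_nf
      have e3 : Real.exp (u / 2) * Real.exp (-(u / 2)) = 1 := by
        rw [← Real.exp_add]; simp
      have e4 : 1 + Real.exp (-u) ≤ 2 * Real.exp (u ^ 2 / 8 - u / 2) := by
        rw [e1, e2]
        nlinarith [Real.exp_pos (-(u / 2))]
      cases b i <;> simp <;> linarith
    · rw [if_pos hi, ← Real.exp_add, ← nsmul_eq_mul]
      apply Finset.sum_le_card_nsmul
      intro c _
      have h1 : (1 : ℝ) ≤ Real.exp (u ^ 2 / 8 - u / 2 + u / 2) := by
        rw [Real.one_le_exp_iff]; ring_nf; positivity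
      split_ifs
      · exact h1
      · exact le_trans (by simpa using hu) h1
  calc (((Fintype.piFinset t).filter fun a => (hammingDist b a : ℝ) ≤ r).card : ℝ)
      ≤ ∑ a ∈ (Fintype.piFinset t).filter (fun a => (hammingDist b a : ℝ) ≤ r),
          Real.exp (u * r) * Real.exp (-u * hammingDist b a) := by
        rw [← nsmul_one]
        apply Finset.card_nsmul_le_sum
        intro a ha
        rw [← Real.exp_add, Real.one_le_exp_iff]
        nlinarith [(Finset.mem_filter.1 ha).2]
    _ ≤ ∑ a ∈ Fintype.piFinset t, Real.exp (u * r) * Real.exp (-u * hammingDist b a) :=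
        Finset.sum_le_sum_of_subset_of_nonneg (Finset.filter_subset _ _)
          fun _ _ _ => by positivity
    _ = Real.exp (u * r) * ∏ i, ∑ c ∈ t i, (if b i = c then 1 else Real.exp (-u)) := by
        rw [← Finset.mul_sum, Finset.prod_univ_sum]
        simp only [exp_mul_hammingDist]
    _ ≤ Real.exp (u * r) * ∏ i, ((t i).card * (Real.exp (u ^ 2 / 8 - u / 2) *
        if t i ≠ Finset.univ then Real.exp (u / 2) else 1)) := by
        refine mul_le_mul_of_nonneg_left (Finset.prod_le_prod (fun i _ => ?_) fun i _ => hfac i)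
          (Real.exp_pos _).le
        exact Finset.sum_nonneg fun c _ => by split_ifs <;> positivity
    _ = _ := by
        rw [Finset.prod_mul_distrib, Finset.prod_mul_distrib, Finset.prod_const, Finset.prod_ite,
          Finset.prod_const, Finset.prod_const_one, Fintype.card_piFinset, Real.exp_add,
          Real.exp_add, Real.exp_nat_mul, Real.exp_nat_mul, Finset.card_univ, Fintype.card_fin,
          Nat.cast_prod, restricted]
        ring

theorem lt_randQueryComplexity (hk : 1 ≤ k) (hr : 0 ≤ radius k) {d : ℕ}
    {P : PMF (DecisionTree (Pos k) (Symbol k))} (hP : ComputesWithQueries P (ApInd k) d) :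
    √((k : ℝ) * Real.logb 2 k) / 4 < d := by
  classical
  by_contra! hd
  set s := √((k : ℝ) * Real.logb 2 k) with hs
  have hk0 : (0 : ℝ) < k := by exact_mod_cast hk
  have hk1 : (1 : ℝ) ≤ k := by exact_mod_cast hk
  have hlog0 : 0 ≤ Real.logb 2 k := Real.logb_nonneg (by norm_num) hk1
  have hs2 : s ^ 2 = k * Real.logb 2 k := Real.sq_sqrt (by positivity)
  have hs0 : 0 ≤ s := Real.sqrt_nonneg _
  have hlog : Real.log k ≤ Real.logb 2 k := by
    rw [Real.logb, le_div_iff₀ (Real.log_pos (by norm_num))]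
    have : Real.log 2 ≤ 1 := by linarith [Real.log_two_lt_d9]
    nlinarith [Real.log_nonneg hk1]
  have hlogk : Real.logb 2 k ≤ k := by
    rw [Real.logb_le_iff_le_rpow (by norm_num) hk0, Real.rpow_natCast]
    exact_mod_cast (Nat.lt_two_pow_self).le
  have hsk : s ≤ k := by
    apply Real.sqrt_le_iff.2
    constructor
    · exact hk0.le
    · nlinarith
  have hball : ∀ t : Fin k → Finset Bool, (restricted t).card ≤ d → ∀ b,
      (((Fintype.piFinset t).filter fun a => (hammingDist b a : ℝ) ≤ radius k).card : ℝ) ≤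
        (1 / k) * (Fintype.piFinset t).card := by
    intro t ht b
    -- With u = 2s/k the exponent is −(3/2) log k for the full cube, and the at most s/4 restricted
    -- coordinates add at most (1/4) log k.
    refine (card_ball_le t b (radius k) (2 * s / k) (by positivity)).trans ?_
    gcongr
    have ht' : ((restricted t).card : ℝ) ≤ s / 4 := le_trans (by exact_mod_cast ht) hd
    calc _ ≤ Real.exp (-Real.log k) := by
          apply Real.exp_le_exp.2
          have hss : s * (s / k) = Real.logb 2 k := by
            field_simp; linarith
          have h1 : ((restricted t).card : ℝ) * (2 * s / k / 2) ≤ Real.logb 2 k / 4 := by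
            calc _ ≤ s / 4 * (2 * s / k / 2) := by gcongr
              _ = _ := by rw [← hss]; ring
          have h2 : 2 * s / k * radius k + k * ((2 * s / k) ^ 2 / 8 - 2 * s / k / 2) =
              - (3 / 2) * Real.logb 2 k := by
            rw [← hss, radius, ← hs]
            field_simp
            ring
          linarith
      _ = 1 / k := by rw [Real.exp_neg, Real.exp_log hk0, one_div]
  have hbad : ∀ T ∈ P.support, 4 * ((Finset.univ : Finset (Fin k → Bool)).filter
      fun a => Probes (radius k) T a).card ≤ 2 ^ k := by
    intro T hT
    have h := card_probes_le (by positivity) hball T (fun _ => Finset.univ) d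
      (by simp [restricted]) (fun a _ => hP.1 T hT _)
    rw [Fintype.piFinset_univ] at h
    have h1 : (d : ℝ) * (1 / k) ≤ 1 / 4 := by
      rw [mul_one_div, div_le_iff₀ hk0]; linarith
    have h2 : ((Finset.univ : Finset (Fin k → Bool)).card : ℝ) = 2 ^ k := by simp
    rw [h2] at h
    have h3 : (4 * ((Finset.univ : Finset (Fin k → Bool)).filter
      fun a => Probes (radius k) T a).card : ℝ) ≤ 2 ^ k := by
      have := mul_le_mul_of_nonneg_right h1 (by positivity : (0 : ℝ) ≤ 2 ^ k)
      linarith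
    exact_mod_cast h3
  -- For each address the tree is right on the value it outputs on the blank input; it can be right
  -- on the other value too only if it probes the ball.
  have hcount : ∀ T ∈ P.support, (Finset.univ.filter fun j : (Fin k → Bool) × Bool =>
      T.eval (canonical j.1 j.2) = j.2).card ≤ 2 ^ k + 2 ^ k / 4 := by
    intro T hT
    let Bad := (Finset.univ : Finset (Fin k → Bool)).filter fun a => Probes (radius k) T a
    have hb : 4 * Bad.card ≤ 2 ^ k := hbad T hT
    have hsub : (Finset.univ.filter fun j : (Fin k → Bool) × Bool =>
        T.eval (canonical j.1 j.2) = j.2) ⊆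
        (Finset.univ.image fun a => (a, T.eval (blank a))) ∪
          Bad.image fun a => (a, !(T.eval (blank a))) := by
      rintro ⟨a, z⟩ h
      simp only [Finset.mem_filter, Finset.mem_univ, true_and] at h
      rw [Finset.mem_union]
      by_cases hz : T.eval (blank a) = z
      · exact Or.inl (Finset.mem_image.2 ⟨a, Finset.mem_univ _, by rw [hz]⟩)
      · refine Or.inr (Finset.mem_image.2 ⟨a, Finset.mem_filter.2 ⟨Finset.mem_univ _, ?_⟩, ?_⟩)
        · by_contra hnp
          exact hz ((eval_canonical_of_not_probes hnp z).symm.trans h)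
        · rw [Bool.not_eq.2 hz]
    have h1 := (Finset.card_le_card hsub).trans (Finset.card_union_le _ _)
    have h2 : (Finset.univ.image fun a : Fin k → Bool => (a, T.eval (blank a))).card ≤ 2 ^ k :=
      Finset.card_image_le.trans (by simp)
    have h3 : (Bad.image fun a => (a, !(T.eval (blank a)))).card ≤ Bad.card :=
      Finset.card_image_le
    omega
  have := two_mul_card_le_of_computesWithQueries hP
    (fun j : (Fin k → Bool) × Bool => canonical j.1 j.2) (fun j => j.2)
    (fun j => ApInd_canonical hr j.1 j.2) _ hcount
  simp only [Fintype.card_prod, Fintype.card_fun, Fintype.card_bool, Fintype.card_fin] at this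
  have hpos : 0 < 2 ^ k := by positivity
  omega

end ApInd

/-! ### Min-wise sampling -/

section MinSampling

variable {Ω : Type*} {n : ℕ}

open Classical in
/-- The element of `S` that comes first in the order given by `σ`, and `d` if `S` is empty. -/
noncomputable def firstIn (d : Ω) (σ : Ω ≃ Fin n) (S : Finset Ω) : Ω :=
  if h : S.Nonempty then (S.exists_min_image σ h).choose else d

theorem firstIn_eq {d : Ω} {σ : Ω ≃ Fin n} {S : Finset Ω} {z : Ω} (hz : z ∈ S)
    (hmin : ∀ u ∈ S, σ z ≤ σ u) : firstIn d σ S = z := by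
  have h : S.Nonempty := ⟨z, hz⟩
  obtain ⟨h1, h2⟩ := (S.exists_min_image σ h).choose_spec
  rw [firstIn, dif_pos h]
  exact σ.injective (le_antisymm (h2 z hz) (hmin _ h1))

variable [Fintype Ω] [DecidableEq Ω]

/-- The orders in which `z` comes first among the elements of `U`. -/
def firstOrders (n : ℕ) (U : Finset Ω) (z : Ω) : Finset (Ω ≃ Fin n) :=
  Finset.univ.filter fun σ => ∀ u ∈ U, σ z ≤ σ u

/-- Exchanging the ranks of `z` and `z'` is injective on orders. By symmetry the inequality is an
equality. -/
theorem card_firstOrders_eq {U : Finset Ω} {z z' : Ω} (hz : z ∈ U) (hz' : z' ∈ U) :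
    (firstOrders n U z).card ≤ (firstOrders n U z').card := by
  refine Finset.card_le_card_of_injOn (fun σ => (Equiv.swap z z').trans σ) ?_ ?_
  · intro σ hσ
    simp only [firstOrders, Finset.coe_filter, Finset.mem_univ, true_and, Set.mem_ofPred_eq] at hσ ⊢
    intro u hu
    simp only [Equiv.trans_apply, Equiv.swap_apply_right]
    apply hσ
    rw [Equiv.swap_apply_def]
    split_ifs <;> assumption
  · intro σ _ τ _ h
    ext u
    have := congrArg (fun ρ : Ω ≃ Fin n => ρ (Equiv.swap z z' u)) h
    simpa using congrArg Fin.val this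

/-- In a uniformly random order, the first elements of `S` and `T` coincide with probability at
least `|S ∩ T| / |S ∪ T|`. -/
theorem card_inter_mul_card_le (d : Ω) (S T : Finset Ω) :
    (S ∩ T).card * Fintype.card (Ω ≃ Fin n) ≤
      (S ∪ T).card * (Finset.univ.filter fun σ : Ω ≃ Fin n =>
        firstIn d σ S = firstIn d σ T ∧ firstIn d σ S ∈ S ∩ T).card := by
  rcases (S ∩ T).eq_empty_or_nonempty with h0 | ⟨w, hw⟩
  · simp [h0]
  have hwU : w ∈ S ∪ T := Finset.mem_union_left _ (Finset.mem_inter.1 hw).1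
  have hsub : ∀ z ∈ S ∩ T, z ∈ S ∪ T := fun z hz =>
    Finset.mem_union_left _ (Finset.mem_inter.1 hz).1
  -- Some element of the union always comes first, and all its elements are equally likely to do so.
  have hcover : Fintype.card (Ω ≃ Fin n) ≤ (S ∪ T).card * (firstOrders n (S ∪ T) w).card := by
    calc Fintype.card (Ω ≃ Fin n)
        ≤ ((S ∪ T).biUnion fun z => firstOrders n (S ∪ T) z).card := by
          rw [← Finset.card_univ]
          refine Finset.card_le_card fun σ _ => ?_
          obtain ⟨z, hz, hmin⟩ := (S ∪ T).exists_min_image σ ⟨w, hwU⟩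
          exact Finset.mem_biUnion.2 ⟨z, hz, by simpa [firstOrders] using hmin⟩
      _ ≤ _ := Finset.card_biUnion_le_card_mul _ _ _ fun z hz => card_firstOrders_eq hz hwU
  have hgood : (S ∩ T).card * (firstOrders n (S ∪ T) w).card ≤
      (Finset.univ.filter fun σ : Ω ≃ Fin n =>
        firstIn d σ S = firstIn d σ T ∧ firstIn d σ S ∈ S ∩ T).card := by
    calc _ ≤ ∑ z ∈ S ∩ T, (firstOrders n (S ∪ T) z).card := by
          rw [← smul_eq_mul, ← Finset.sum_const]
          exact Finset.sum_le_sum fun z hz => card_firstOrders_eq hwU (hsub z hz)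
      _ = ((S ∩ T).biUnion fun z => firstOrders n (S ∪ T) z).card := by
          rw [Finset.card_biUnion]
          intro z hz z' hz' hne
          rw [Function.onFun, Finset.disjoint_left]
          intro σ h1 h2
          simp only [firstOrders, Finset.mem_filter, Finset.mem_univ, true_and] at h1 h2
          exact hne (σ.injective (le_antisymm (h1 z' (hsub z' hz')) (h2 z (hsub z hz))))
      _ ≤ _ := by
          refine Finset.card_le_card fun σ hσ => ?_
          obtain ⟨z, hz, hσ⟩ := Finset.mem_biUnion.1 hσ
          simp only [firstOrders, Finset.mem_filter, Finset.mem_univ, true_and] at hσ ⊢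
          have e1 : firstIn d σ S = z := firstIn_eq (Finset.mem_inter.1 hz).1
            fun u hu => hσ u (Finset.mem_union_left _ hu)
          have e2 : firstIn d σ T = z := firstIn_eq (Finset.mem_inter.1 hz).2
            fun u hu => hσ u (Finset.mem_union_right _ hu)
          rw [e1, e2]
          exact ⟨rfl, hz⟩
  calc _ ≤ (S ∩ T).card * ((S ∪ T).card * (firstOrders n (S ∪ T) w).card) :=
        Nat.mul_le_mul_left _ hcover
    _ = (S ∪ T).card * ((S ∩ T).card * (firstOrders n (S ∪ T) w).card) := by ring
    _ ≤ _ := Nat.mul_le_mul_left _ hgood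

end MinSampling

/-! ### Public coin strategies from finite seeds -/

/-- A family of strategy pairs indexed by a finite set of seeds, such that for all `x ∈ f⁻¹(0)` and
`y ∈ f⁻¹(1)` at least a fraction `1 / c` of the seeds gives a correct pair, shows `CGpub f ≤ c`. -/
theorem CGpub_le_of_card_le {ι : Type} {α : ι → Type} (f : (∀ i, α i) → Option Bool)
    {R : Type} [Fintype R] [Nonempty R] (strat : R → StrategyPair ι α) (c : ℝ)
    (h : ∀ x y, f x = some false → f y = some true → ∃ G : Finset R,
      (∀ ρ ∈ G, (strat ρ).Correct x y) ∧ (Fintype.card R : ℝ) ≤ c * G.card) :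
    CGpub f ≤ ENNReal.ofReal c := by
  classical
  refine (iInf_le _ ((PMF.uniformOfFintype R).map strat)).trans ?_
  refine iSup_le fun x => iSup_le fun y => iSup_le fun hx => iSup_le fun hy => ?_
  obtain ⟨G, hG, hcard⟩ := h x y hx hy
  have hR : 0 < (Fintype.card R : ℝ) := by exact_mod_cast Fintype.card_pos
  have hGpos : 0 < (G.card : ℝ) := by
    rcases (Nat.cast_nonneg G.card : (0 : ℝ) ≤ G.card).eq_or_lt with h0 | h0
    · rw [← h0] at hcard; linarith
    · exact h0
  have hc : 0 < c := by
    by_contra! hc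
    nlinarith
  have hwin : ENNReal.ofReal c⁻¹ ≤ winProb ((PMF.uniformOfFintype R).map strat) x y := by
    rw [winProb, PMF.toOuterMeasure_map_apply]
    calc ENNReal.ofReal c⁻¹ ≤ ENNReal.ofReal (G.card / Fintype.card R) := by
          apply ENNReal.ofReal_le_ofReal
          rw [inv_le_iff_one_le_mul₀ hc, div_mul_eq_mul_div, le_div_iff₀ hR]
          linarith
      _ = G.card / Fintype.card R := by
          rw [ENNReal.ofReal_div_of_pos hR, ENNReal.ofReal_natCast, ENNReal.ofReal_natCast]
      _ = (PMF.uniformOfFintype R).toOuterMeasure (G : Set R) := by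
          rw [PMF.toOuterMeasure_uniformOfFintype_apply]
          simp
      _ ≤ _ := (PMF.uniformOfFintype R).toOuterMeasure.mono fun ρ hρ => hG ρ hρ
  calc (winProb ((PMF.uniformOfFintype R).map strat) x y)⁻¹ ≤ (ENNReal.ofReal c⁻¹)⁻¹ :=
        ENNReal.inv_le_inv.2 hwin
    _ = ENNReal.ofReal c := by rw [ENNReal.ofReal_inv_of_pos hc, inv_inv]

/-! ### Product weights on the Boolean cube -/

section ProductWeight

variable {k : ℕ}

/-- The product weight centred at `a`, with a factor `u` for each coordinate of agreement and `v`
for each coordinate of disagreement. -/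
noncomputable def productWeight (u v : ℝ) (a b : Fin k → Bool) : ℝ :=
  ∏ i, if a i = b i then u else v

theorem productWeight_nonneg {u v : ℝ} (hu : 0 ≤ u) (hv : 0 ≤ v) (a b : Fin k → Bool) :
    0 ≤ productWeight u v a b :=
  Finset.prod_nonneg fun i _ => by split_ifs <;> assumption

theorem sum_productWeight (u v : ℝ) (a : Fin k → Bool) :
    ∑ b, productWeight u v a b = (u + v) ^ k := by
  simpa [productWeight] using sum_prod_ite_eq a u v

/-- Lower bound for the overlap of two product weights, through the Bhattacharyya coefficient. -/
theorem pow_le_sum_min_productWeight {u v : ℝ} (hu : 0 ≤ u) (hv : 0 ≤ v) (a a' : Fin k → Bool) :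
    ∏ i, (if a i = a' i then (u + v) ^ 2 else 4 * (u * v)) ≤
      (∑ b, min (productWeight u v a b) (productWeight u v a' b)) * (2 * (u + v) ^ k) := by
  set g : Fin k → Bool → ℝ := fun i c =>
    √((if a i = c then u else v) * if a' i = c then u else v) with hg
  have hw : ∀ i c, 0 ≤ (if a i = c then u else v) * if a' i = c then u else v := fun i c =>
    mul_nonneg (by split_ifs <;> assumption) (by split_ifs <;> assumption)
  have hsq : ∀ b : Fin k → Bool, (∏ i, g i (b i)) ^ 2 =
      min (productWeight u v a b) (productWeight u v a' b) *
        max (productWeight u v a b) (productWeight u v a' b) := by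
    intro b
    rw [min_mul_max, productWeight, productWeight, ← Finset.prod_mul_distrib, ← Finset.prod_pow]
    exact Finset.prod_congr rfl fun i _ => Real.sq_sqrt (hw i (b i))
  -- Cauchy–Schwarz with min · max equal to the product of the weights. The sum of their geometric
  -- means factors over coordinates, into u + v or 2√(uv), and the sum of the maxima is at most
  -- twice the total weight.
  have hcs := Finset.sum_sq_le_sum_mul_sum_of_sq_le_mul Finset.univ
    (fun b _ => le_min (productWeight_nonneg hu hv a b) (productWeight_nonneg hu hv a' b))
    (fun b _ => le_max_of_le_left (productWeight_nonneg hu hv a b)) (fun b _ => (hsq b).le)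
  have hfac : ∀ i, (g i true + g i false) ^ 2 =
      if a i = a' i then (u + v) ^ 2 else 4 * (u * v) := by
    intro i
    have h1 : √(u * u) = u := Real.sqrt_mul_self hu
    have h2 : √(v * v) = v := Real.sqrt_mul_self hv
    have h3 : √(u * v) ^ 2 = u * v := Real.sq_sqrt (mul_nonneg hu hv)
    simp only [hg]
    cases a i <;> cases a' i <;> simp only [reduceCtorEq, if_true, if_false, h1, h2]
    · ring
    · rw [mul_comm v u]; linear_combination 4 * h3
    · rw [mul_comm v u]; linear_combination 4 * h3
  rw [sum_prod_bool, ← Finset.prod_pow, Finset.prod_congr rfl fun i _ => hfac i] at hcs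
  refine hcs.trans (mul_le_mul_of_nonneg_left ?_ ?_)
  · calc _ ≤ ∑ b, (productWeight u v a b + productWeight u v a' b) :=
          Finset.sum_le_sum fun b _ => max_le_add_of_nonneg (productWeight_nonneg hu hv a b)
            (productWeight_nonneg hu hv a' b)
      _ = _ := by rw [Finset.sum_add_distrib, sum_productWeight, sum_productWeight, two_mul]
  · exact Finset.sum_nonneg fun b _ =>
      le_min (productWeight_nonneg hu hv a b) (productWeight_nonneg hu hv a' b)

open Classical in
/-- Chernoff bound for the weight outside a Hamming ball. -/
theorem sum_productWeight_far_le {u v : ℝ} (hu : 0 ≤ u) (hv : 0 ≤ v) (a : Fin k → Bool) (r t : ℝ)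
    (ht : 0 ≤ t) :
    ∑ b with ¬ (hammingDist b a : ℝ) ≤ r, productWeight u v a b ≤
      Real.exp (-t * r) * (u + v * Real.exp t) ^ k := by
  have hterm : ∀ b, productWeight u v a b * (Real.exp (-t * r) * Real.exp (t * hammingDist a b)) =
      Real.exp (-t * r) * productWeight u (v * Real.exp t) a b := by
    intro b
    have : productWeight u v a b * Real.exp (t * hammingDist a b) =
        productWeight u (v * Real.exp t) a b := by
      rw [exp_mul_hammingDist, productWeight, productWeight, ← Finset.prod_mul_distrib]
      refine Finset.prod_congr rfl fun i _ => ?_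
      split_ifs <;> simp
    rw [← this]; ring
  calc _ ≤ ∑ b with ¬ (hammingDist b a : ℝ) ≤ r,
        productWeight u v a b * (Real.exp (-t * r) * Real.exp (t * hammingDist a b)) := by
        refine Finset.sum_le_sum fun b hb => ?_
        refine le_mul_of_one_le_right (productWeight_nonneg hu hv a b) ?_
        have hb' := not_le.1 (Finset.mem_filter.1 hb).2
        rw [← Real.exp_add, Real.one_le_exp_iff, hammingDist_comm]
        nlinarith
    _ ≤ ∑ b, productWeight u v a b * (Real.exp (-t * r) * Real.exp (t * hammingDist a b)) :=
        Finset.sum_le_sum_of_subset_of_nonneg (Finset.filter_subset _ _) fun b _ _ =>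
          mul_nonneg (productWeight_nonneg hu hv a b) (by positivity)
    _ = _ := by simp only [hterm, ← Finset.mul_sum, sum_productWeight]

-- Truncating both weights to their balls costs at most the two masses outside.
open Classical in
theorem sum_min_productWeight_le {u v : ℝ} (hu : 0 ≤ u) (hv : 0 ≤ v) (a a' : Fin k → Bool)
    (r : ℝ) :
    ∑ b, min (productWeight u v a b) (productWeight u v a' b) ≤
      ∑ b with (hammingDist b a : ℝ) ≤ r ∧ (hammingDist b a' : ℝ) ≤ r,
        min (productWeight u v a b) (productWeight u v a' b) +
      ∑ b with ¬ (hammingDist b a : ℝ) ≤ r, productWeight u v a b +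
      ∑ b with ¬ (hammingDist b a' : ℝ) ≤ r, productWeight u v a' b := by
  simp only [Finset.sum_filter, ← Finset.sum_add_distrib]
  refine Finset.sum_le_sum fun b _ => ?_
  have h1 := productWeight_nonneg hu hv a b
  have h2 := productWeight_nonneg hu hv a' b
  by_cases c1 : (hammingDist b a : ℝ) ≤ r <;> by_cases c2 : (hammingDist b a' : ℝ) ≤ r <;>
    simp only [c1, c2, and_self, and_true, and_false, if_true, if_false, not_true, not_false_eq_true] <;>
    linarith [min_le_left (productWeight u v a b) (productWeight u v a' b),
      min_le_right (productWeight u v a b) (productWeight u v a' b)]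

end ProductWeight

/-- Integer weights become numbers of points under a graph, so that min-wise sampling from finite
sets also samples from weighted distributions. -/
theorem card_filter_prod_lt {β : Type*} [Fintype β] (q : β → Prop) [DecidablePred q] (w : β → ℕ)
    (M : ℕ) (hw : ∀ b, w b ≤ M) :
    (Finset.univ.filter fun z : β × Fin M => q z.1 ∧ (z.2 : ℕ) < w z.1).card =
      ∑ b with q b, w b := by
  classical
  rw [Finset.sum_filter, Finset.card_filter, Fintype.sum_prod_type]
  refine Finset.sum_congr rfl fun b _ => ?_
  by_cases h : q b
  · simp only [h, true_and, if_true]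
    rw [← Finset.card_filter, Fin.card_filter_val_lt, min_eq_right (hw b)]
  · simp [h]

/-! ### The public coin certificate game for the approximate index function -/

namespace ApInd

variable {k : ℕ}

/-- Integral product weights with bias `p`. -/
def biasedWeight (p : ℕ) (a b : Fin k → Bool) : ℕ :=
  ∏ i, if a i = b i then k + p else k - p

theorem cast_biasedWeight {p : ℕ} (hp : p ≤ k) (a b : Fin k → Bool) :
    (biasedWeight p a b : ℝ) = productWeight ((k : ℝ) + p) (k - p) a b := by
  rw [biasedWeight, productWeight, Nat.cast_prod]
  refine Finset.prod_congr rfl fun i _ => ?_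
  split_ifs <;> push_cast [Nat.cast_sub hp] <;> rfl

theorem biasedWeight_le (p : ℕ) (a b : Fin k → Bool) : biasedWeight p a b ≤ (k + p) ^ k := by
  refine (Finset.prod_le_pow_card _ _ (k + p) fun i _ => ?_).trans (by simp)
  split_ifs <;> omega

open Classical in
/-- The region under the graph of the biased weight at `a`, restricted to the ball around `a`. -/
noncomputable def region (p : ℕ) (a : Fin k → Bool) :
    Finset ((Fin k → Bool) × Fin ((k + p) ^ k)) :=
  Finset.univ.filter fun z => (hammingDist z.1 a : ℝ) ≤ radius k ∧ (z.2 : ℕ) < biasedWeight p a z.1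

theorem card_region_le {p : ℕ} (hp : p ≤ k) (a : Fin k → Bool) :
    ((region p a).card : ℝ) ≤ (2 * k : ℝ) ^ k := by
  classical
  have hv : (0 : ℝ) ≤ k - p := sub_nonneg.2 (by exact_mod_cast hp)
  have h := card_filter_prod_lt (fun b : Fin k → Bool => (hammingDist b a : ℝ) ≤ radius k)
    (biasedWeight p a) _ (biasedWeight_le p a)
  rw [region, h, Nat.cast_sum]
  simp only [cast_biasedWeight hp]
  calc _ ≤ ∑ b, productWeight ((k : ℝ) + p) (k - p) a b :=
        Finset.sum_le_sum_of_subset_of_nonneg (Finset.filter_subset _ _) fun b _ _ =>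
          productWeight_nonneg (by positivity) hv a b
    _ = _ := by rw [sum_productWeight]; ring_nf

open Classical in
theorem card_region_inter {p : ℕ} (hp : p ≤ k) (a a' : Fin k → Bool) :
    ((region p a ∩ region p a').card : ℝ) =
      ∑ b with (hammingDist b a : ℝ) ≤ radius k ∧ (hammingDist b a' : ℝ) ≤ radius k,
        min (productWeight ((k : ℝ) + p) (k - p) a b)
          (productWeight ((k : ℝ) + p) (k - p) a' b) := by
  have h := card_filter_prod_lt
    (fun b : Fin k → Bool => (hammingDist b a : ℝ) ≤ radius k ∧ (hammingDist b a' : ℝ) ≤ radius k)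
    (fun b => min (biasedWeight p a b) (biasedWeight p a' b)) ((k + p) ^ k)
    (fun b => (min_le_left _ _).trans (biasedWeight_le p a b))
  have e : region p a ∩ region p a' = Finset.univ.filter fun z =>
      ((hammingDist z.1 a : ℝ) ≤ radius k ∧ (hammingDist z.1 a' : ℝ) ≤ radius k) ∧
        (z.2 : ℕ) < min (biasedWeight p a z.1) (biasedWeight p a' z.1) := by
    ext z
    simp only [region, Finset.mem_inter, Finset.mem_filter, Finset.mem_univ, true_and, lt_min_iff]
    tauto
  rw [e, h, Nat.cast_sum]
  simp only [Nat.cast_min, cast_biasedWeight hp]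

/-- Under the normalised weight a coordinate is flipped with probability (k − p)/(2k), so the mean
distance is at most k/2 − 2s, a margin s below the radius. The Chernoff parameter s/k gives e^(−(log
k)/2) ≤ e^(−3) < 1/16. -/
theorem exp_mul_pow_le_div_sixteen (hk : 1 ≤ k) (hL : 6 ≤ Real.logb 2 k) {p : ℕ} (hp : p ≤ k)
    (hsp : 4 * √((k : ℝ) * Real.logb 2 k) ≤ p) :
    Real.exp (-(√((k : ℝ) * Real.logb 2 k) / k) * radius k) * ((k + p : ℝ) +
      (k - p) * Real.exp (√((k : ℝ) * Real.logb 2 k) / k)) ^ k ≤ (2 * k : ℝ) ^ k / 16 := by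
  set s := √((k : ℝ) * Real.logb 2 k) with hs
  have hk0 : (0 : ℝ) < k := by exact_mod_cast hk
  have hpk : (p : ℝ) ≤ k := by exact_mod_cast hp
  have hs2 : s ^ 2 = k * Real.logb 2 k := Real.sq_sqrt (by positivity)
  have hs0 : 0 ≤ s := Real.sqrt_nonneg _
  set u := s / k with hu
  have hu0 : 0 ≤ u := by positivity
  have hu1 : u ≤ 1 := by rw [hu, div_le_one hk0]; linarith
  have hus : u * s = Real.logb 2 k := by rw [hu]; field_simp; linarith
  have huk : k * u = s := by rw [hu]; field_simp
  have hexp : Real.exp u - 1 ≤ u + u ^ 2 := by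
    have := (abs_le.1 (Real.abs_exp_sub_one_sub_id_le (x := u) (by rwa [abs_of_nonneg hu0]))).2
    linarith
  have hbase : (k + p : ℝ) + (k - p) * Real.exp u ≤
      2 * k * Real.exp ((k - p) * (u + u ^ 2) / (2 * k)) := by
    calc (k + p : ℝ) + (k - p) * Real.exp u ≤ 2 * k * ((k - p) * (u + u ^ 2) / (2 * k) + 1) := by
          have h1 : 2 * k * ((k - p) * (u + u ^ 2) / (2 * k) + 1) =
            (k - p) * (u + u ^ 2) + 2 * k := by field_simp
          rw [h1]
          nlinarith [mul_le_mul_of_nonneg_left hexp (sub_nonneg.2 hpk)]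
      _ ≤ _ := by gcongr; exact Real.add_one_le_exp _
  have hnn : 0 ≤ (k + p : ℝ) + (k - p) * Real.exp u :=
    add_nonneg (by positivity) (mul_nonneg (sub_nonneg.2 hpk) (Real.exp_pos _).le)
  calc _ ≤ Real.exp (-u * radius k) *
        (2 * k * Real.exp ((k - p) * (u + u ^ 2) / (2 * k))) ^ k := by gcongr
    _ = (2 * k : ℝ) ^ k * Real.exp (-u * radius k + (k - p) * (u + u ^ 2) / 2) := by
        rw [mul_pow, ← Real.exp_nat_mul, Real.exp_add]
        have : (k : ℝ) * ((k - p) * (u + u ^ 2) / (2 * k)) = (k - p) * (u + u ^ 2) / 2 := by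
          field_simp
        rw [this]; ring
    _ ≤ (2 * k : ℝ) ^ k * Real.exp (-3) := by
        gcongr
        rw [radius, ← hs]
        have h1 : (k - p : ℝ) * u ≤ (k - 4 * s) * u := by gcongr
        have h2 : (k - p : ℝ) * u ^ 2 ≤ k * u ^ 2 := by gcongr; simp
        have h3 : k * u ^ 2 = Real.logb 2 k := by rw [← hus, ← huk]; ring
        nlinarith
    _ ≤ (2 * k : ℝ) ^ k * (1 / 16) := by
        gcongr
        rw [Real.exp_neg, ← one_div]
        apply one_div_le_one_div_of_le (by norm_num)
        have h1 : Real.exp 3 = Real.exp 1 ^ 3 := by rw [← Real.exp_nat_mul]; norm_num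
        rw [h1]
        have h2 : (2.7 : ℝ) ≤ Real.exp 1 := by linarith [Real.exp_one_gt_d9]
        calc (16 : ℝ) ≤ 2.7 ^ 3 := by norm_num
          _ ≤ _ := by gcongr
    _ = _ := by ring

/-- With Z = (2k)^k, each differing coordinate costs a factor 1 − (p/k)² in the squared
Bhattacharyya coefficient. Since (p/k)² ≤ 25 (log k)/k, Bernoulli's inequality keeps at least half
of Z². This gives overlap Z/4, and truncation removes at most 2 · Z/16. -/
theorem card_region_inter_ge (hk : 1 ≤ k) (hL : 6 ≤ Real.logb 2 k) {p : ℕ} (hp : p ≤ k)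
    (hsp : 4 * √((k : ℝ) * Real.logb 2 k) ≤ p) (hps : p ≤ 5 * √((k : ℝ) * Real.logb 2 k))
    (a a' : Fin k → Bool) (hd : hammingDist a a' * (50 * Real.logb 2 k) ≤ k) :
    (2 * k : ℝ) ^ k / 8 ≤ (region p a ∩ region p a').card := by
  classical
  have hk0 : (0 : ℝ) < k := by exact_mod_cast hk
  have hpk : (p : ℝ) ≤ k := by exact_mod_cast hp
  have hu : (0 : ℝ) ≤ k + p := by positivity
  have hv : (0 : ℝ) ≤ k - p := sub_nonneg.2 hpk
  set Z := (2 * k : ℝ) ^ k with hZ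
  have hZ0 : 0 < Z := by positivity
  have huv : ((k : ℝ) + p + (k - p)) = 2 * k := by ring
  have hover := pow_le_sum_min_productWeight hu hv a a'
  rw [huv, ← hZ] at hover
  have hprod : Z ^ 2 / 2 ≤ ∏ i, (if a i = a' i then (2 * k : ℝ) ^ 2
      else 4 * ((k + p) * (k - p))) := by
    have e1 : ∀ i, (if a i = a' i then (2 * k : ℝ) ^ 2 else 4 * ((k + p) * (k - p))) =
        (2 * k : ℝ) ^ 2 * if a i = a' i then 1 else 1 + -((p : ℝ) / k) ^ 2 := by
      intro i
      split_ifs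
      · ring
      · field_simp; ring
    rw [Finset.prod_congr rfl fun i _ => e1 i, Finset.prod_mul_distrib, Finset.prod_const,
      Finset.card_univ, Fintype.card_fin, Finset.prod_ite, Finset.prod_const_one, one_mul,
      Finset.prod_const]
    change _ ≤ _ * _ ^ hammingDist a a'
    have hpk1 : ((p : ℝ) / k) ^ 2 ≤ 1 := by
      apply pow_le_one₀ (by positivity)
      rwa [div_le_one hk0]
    have hb := one_add_mul_le_pow (a := -((p : ℝ) / k) ^ 2) (by linarith) (hammingDist a a')
    have hsq : ((p : ℝ) / k) ^ 2 ≤ 25 * Real.logb 2 k / k := by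
      rw [div_pow, div_le_div_iff₀ (by positivity) hk0]
      have : (p : ℝ) ^ 2 ≤ 25 * (k * Real.logb 2 k) := by
        calc (p : ℝ) ^ 2 ≤ (5 * √((k : ℝ) * Real.logb 2 k)) ^ 2 := by gcongr
          _ = _ := by rw [mul_pow, Real.sq_sqrt (by positivity)]; norm_num
      nlinarith
    have hhalf : (hammingDist a a' : ℝ) * ((p : ℝ) / k) ^ 2 ≤ 1 / 2 := by
      calc _ ≤ (hammingDist a a' : ℝ) * (25 * Real.logb 2 k / k) := by gcongr
        _ = (hammingDist a a' * (50 * Real.logb 2 k)) / k / 2 := by ring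
        _ ≤ 1 / 2 := by gcongr; rwa [div_le_one hk0]
    have hZ2 : ((2 * k : ℝ) ^ 2) ^ k = Z ^ 2 := by rw [hZ, ← pow_mul, ← pow_mul, Nat.mul_comm]
    rw [hZ2, div_eq_mul_one_div]
    gcongr
    linarith
  have hmin : Z / 4 ≤ ∑ b, min (productWeight ((k : ℝ) + p) (k - p) a b)
      (productWeight ((k : ℝ) + p) (k - p) a' b) := by
    have := hprod.trans hover
    by_contra! hlt
    nlinarith
  have hnear := sum_min_productWeight_le hu hv a a' (radius k)
  rw [← card_region_inter hp] at hnear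
  have hfar : ∀ a : Fin k → Bool, ∑ b with ¬ (hammingDist b a : ℝ) ≤ radius k,
      productWeight ((k : ℝ) + p) (k - p) a b ≤ Z / 16 := fun a =>
    (sum_productWeight_far_le hu hv a (radius k) (√((k : ℝ) * Real.logb 2 k) / k)
      (by positivity)).trans (exp_mul_pow_le_div_sixteen hk hL hp hsp)
  linarith [hfar a, hfar a']

theorem table_of_ApInd_eq {x : Input k} {z : Bool} (hx : ApInd k x = some z) {b : Fin k → Bool}
    (hb : (hammingDist b (address x) : ℝ) ≤ radius k) :
    table x b = if z then 1 else 0 := by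
  obtain ⟨⟨h01, hv⟩, hz⟩ := ApInd_eq_some_iff.1 hx
  rw [(hv b).1 hb]
  rcases h01 with h | h <;> rw [h] at hz ⊢ <;> subst hz <;> simp

/-- Both players output the same random address position, or the label of the first element of
their regions in a random order. -/
noncomputable def outputPos (p : ℕ) (d : (Fin k → Bool) × Fin ((k + p) ^ k))
    (ρ : Bool × Fin k × ((Fin k → Bool) × Fin ((k + p) ^ k) ≃
      Fin (Fintype.card ((Fin k → Bool) × Fin ((k + p) ^ k))))) (x : Input k) : Pos k :=
  if ρ.1 then Sum.inl ρ.2.1 else Sum.inr (firstIn d ρ.2.2 (region p (address x))).1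

theorem CGpub_ApInd_le (hk : 1 ≤ k) (hL : 6 ≤ Real.logb 2 k)
    (hsk : 4 * √((k : ℝ) * Real.logb 2 k) + 1 ≤ k) :
    CGpub (ApInd k) ≤ ENNReal.ofReal (100 * Real.logb 2 k) := by
  classical
  have hk0 : (0 : ℝ) < k := by exact_mod_cast hk
  have hk1 : (1 : ℝ) ≤ k := by exact_mod_cast hk
  have hs1 : 1 ≤ √((k : ℝ) * Real.logb 2 k) := by
    rw [Real.one_le_sqrt]; nlinarith
  set p := ⌈4 * √((k : ℝ) * Real.logb 2 k)⌉₊ with hpdef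
  have hsp : 4 * √((k : ℝ) * Real.logb 2 k) ≤ p := Nat.le_ceil _
  have hp1 : (p : ℝ) < 4 * √((k : ℝ) * Real.logb 2 k) + 1 := Nat.ceil_lt_add_one (by positivity)
  have hp : p ≤ k := by
    have : (p : ℝ) ≤ k := by linarith
    exact_mod_cast this
  have hps : (p : ℝ) ≤ 5 * √((k : ℝ) * Real.logb 2 k) := by linarith
  -- Only a default for `firstIn` on an empty region; the seeds counted below never rely on it.
  let d : (Fin k → Bool) × Fin ((k + p) ^ k) := (fun _ => false, ⟨0, by positivity⟩)
  have : Nonempty (Fin k) := ⟨⟨0, hk⟩⟩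
  have : Nonempty ((Fin k → Bool) × Fin ((k + p) ^ k) ≃
      Fin (Fintype.card ((Fin k → Bool) × Fin ((k + p) ^ k)))) := ⟨Fintype.equivFin _⟩
  refine CGpub_le_of_card_le (ApInd k) (fun ρ => (outputPos p d ρ, outputPos p d ρ)) _ ?_
  intro x y hx hy
  set N := Fintype.card ((Fin k → Bool) × Fin ((k + p) ^ k) ≃
      Fin (Fintype.card ((Fin k → Bool) × Fin ((k + p) ^ k)))) with hN
  have hcard : (Fintype.card (Bool × Fin k × ((Fin k → Bool) × Fin ((k + p) ^ k) ≃
      Fin (Fintype.card ((Fin k → Bool) × Fin ((k + p) ^ k))))) : ℝ) = 2 * k * N := by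
    rw [Fintype.card_prod, Fintype.card_prod, Fintype.card_bool, Fintype.card_fin, ← hN]
    push_cast; ring
  by_cases hd : hammingDist (address x) (address y) * (50 * Real.logb 2 k) ≤ k
  · have hmh := card_inter_mul_card_le
      (n := Fintype.card ((Fin k → Bool) × Fin ((k + p) ^ k))) d
      (region p (address x)) (region p (address y))
    set good := Finset.univ.filter fun σ : (Fin k → Bool) × Fin ((k + p) ^ k) ≃
        Fin (Fintype.card ((Fin k → Bool) × Fin ((k + p) ^ k))) =>
      firstIn d σ (region p (address x)) = firstIn d σ (region p (address y)) ∧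
        firstIn d σ (region p (address x)) ∈ region p (address x) ∩ region p (address y) with hgood
    refine ⟨{false} ×ˢ (Finset.univ ×ˢ good), ?_, ?_⟩
    · rintro ⟨c, i, σ⟩ hρ
      simp only [Finset.mem_product, Finset.mem_singleton, Finset.mem_univ, true_and, hgood,
        Finset.mem_filter] at hρ
      obtain ⟨rfl, he, hmem⟩ := hρ
      rw [Finset.mem_inter] at hmem
      have hxr := (Finset.mem_filter.1 hmem.1).2.1
      have hyr := (Finset.mem_filter.1 hmem.2).2.1
      refine ⟨Sum.inr (firstIn d σ (region p (address x))).1, rfl, ?_, ?_⟩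
      · simp [outputPos, he]
      · have h1 := table_of_ApInd_eq hx hxr
        have h2 := table_of_ApInd_eq hy hyr
        change table x _ ≠ table y _
        rw [h1, h2]
        decide
    · rw [hcard, Finset.card_product, Finset.card_product, Finset.card_singleton,
        Finset.card_univ, Fintype.card_fin]
      have hmh' : ((region p (address x) ∩ region p (address y)).card : ℝ) * N ≤
          (region p (address x) ∪ region p (address y)).card * good.card := by exact_mod_cast hmh
      have hinter := card_region_inter_ge hk hL hp hsp hps (address x) (address y) hd
      have hunion : ((region p (address x) ∪ region p (address y)).card : ℝ) ≤
          2 * (2 * k : ℝ) ^ k := by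
        have h1 : ((region p (address x) ∪ region p (address y)).card : ℝ) ≤
            (region p (address x)).card + (region p (address y)).card := by
          exact_mod_cast Finset.card_union_le _ _
        linarith [card_region_le hp (address x), card_region_le hp (address y)]
      have hZ0 : 0 < (2 * k : ℝ) ^ k := by positivity
      -- Intersection at least Z/8 over union at most 2Z, where Z = (2k)^k.
      have h16 : (N : ℝ) ≤ 16 * good.card := by
        have h1 : (2 * k : ℝ) ^ k / 8 * N ≤ 2 * (2 * k : ℝ) ^ k * good.card :=
          (mul_le_mul_of_nonneg_right hinter (by positivity)).trans
            (hmh'.trans (mul_le_mul_of_nonneg_right hunion (by positivity)))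
        by_contra! hlt
        nlinarith
      push_cast
      calc (2 * k * N : ℝ) ≤ 2 * k * (16 * good.card) := by gcongr
        _ = 32 * (k * good.card) := by ring
        _ ≤ 100 * Real.logb 2 k * (k * good.card) := by gcongr; linarith
        _ = _ := by ring
  -- Far addresses: a random position separates them with probability more than 1/(50 log k), and
  -- the choice of mode costs a factor 2.
  · refine ⟨{true} ×ˢ ((Finset.univ.filter fun i => address x i ≠ address y i) ×ˢ Finset.univ),
      ?_, ?_⟩
    · rintro ⟨c, i, σ⟩ hρ
      simp only [Finset.mem_product, Finset.mem_singleton, Finset.mem_univ, true_and, and_true,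
        Finset.mem_filter] at hρ
      obtain ⟨rfl, hi⟩ := hρ
      exact ⟨Sum.inl i, rfl, rfl, hi⟩
    · rw [hcard, Finset.card_product, Finset.card_product, Finset.card_singleton,
        Finset.card_univ, ← hN]
      change _ ≤ 100 * Real.logb 2 k * ((1 * (hammingDist (address x) (address y) * N) : ℕ) : ℝ)
      push_cast
      have h1 : (k : ℝ) * N ≤ hammingDist (address x) (address y) * (50 * Real.logb 2 k) * N := by
        gcongr
        exact (not_le.1 hd).le
      linarith

end ApInd

/-! ### Asymptotics and the main theorem -/

theorem eventually_four_mul_sqrt_add_one_le :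
    ∀ᶠ k : ℕ in atTop, 4 * √((k : ℝ) * Real.logb 2 k) + 1 ≤ k := by
  have h : Tendsto (fun x : ℝ => Real.log x / x) atTop (nhds 0) :=
    Real.isLittleO_log_id_atTop.tendsto_div_nhds_zero
  have h2 : (0 : ℝ) < Real.log 2 / 64 := div_pos (Real.log_pos (by norm_num)) (by norm_num)
  have hev := (h.comp tendsto_natCast_atTop_atTop).eventually_lt_const h2
  filter_upwards [hev, eventually_ge_atTop 2] with k hk hk2
  have hk0 : (2 : ℝ) ≤ k := by exact_mod_cast hk2
  simp only [Function.comp_apply] at hk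
  rw [div_lt_iff₀ (by linarith)] at hk
  have hL : Real.logb 2 k ≤ k / 64 := by
    rw [Real.logb, div_le_iff₀ (Real.log_pos (by norm_num))]
    linarith
  have hs : √((k : ℝ) * Real.logb 2 k) ≤ k / 8 := by
    apply Real.sqrt_le_iff.2
    constructor
    · positivity
    · nlinarith
  linarith

theorem mainTheorem7 :
    (∃ C : ℝ, ∀ᶠ k : ℕ in atTop, CGpub (ApInd k) ≤ ENNReal.ofReal (C * Real.logb 2 k)) ∧
    ((fun k : ℕ => (randQueryComplexity (ApInd k) : ℝ)) =Θ[atTop]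
      fun k : ℕ => √((k : ℝ) * Real.logb 2 k)) ∧
    (∃ C : ℝ, ∀ᶠ k : ℕ in atTop,
      CGpub (ApInd k) ≤ ENNReal.ofReal (C * Real.logb 2 (randQueryComplexity (ApInd k)))) := by
  have hlog : ∀ k : ℕ, 256 ≤ k → 8 ≤ Real.logb 2 k := by
    intro k hk
    rw [Real.le_logb_iff_rpow_le (by norm_num) (by exact_mod_cast (by omega : 0 < k))]
    norm_num
    exact_mod_cast hk
  have hCG : ∀ᶠ k : ℕ in atTop, CGpub (ApInd k) ≤ ENNReal.ofReal (100 * Real.logb 2 k) := by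
    filter_upwards [eventually_four_mul_sqrt_add_one_le, eventually_ge_atTop 256] with k h hk
    exact ApInd.CGpub_ApInd_le (by omega) (by linarith [hlog k hk]) h
  have hR : ∀ᶠ k : ℕ in atTop,
      √((k : ℝ) * Real.logb 2 k) / 4 ≤ randQueryComplexity (ApInd k) ∧
      (randQueryComplexity (ApInd k) : ℝ) ≤ 5 * √((k : ℝ) * Real.logb 2 k) := by
    filter_upwards [eventually_four_mul_sqrt_add_one_le, eventually_ge_atTop 256] with k h hk
    have hL := hlog k hk
    have hk' : (256 : ℝ) ≤ k := by exact_mod_cast hk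
    have hs1 : 1 ≤ √((k : ℝ) * Real.logb 2 k) := by
      rw [Real.one_le_sqrt]; nlinarith
    obtain ⟨⟨P, hP⟩, hle⟩ := ApInd.randQueryComplexity_le (k := k) (by linarith)
    refine ⟨(ApInd.lt_randQueryComplexity (by omega) ?_ hP).le, by linarith⟩
    unfold ApInd.radius
    linarith
  refine ⟨⟨100, hCG⟩, ⟨?_, ?_⟩, ⟨400, ?_⟩⟩
  · refine IsBigO.of_bound 5 ?_
    filter_upwards [hR] with k hk
    rw [Real.norm_of_nonneg (by positivity), Real.norm_of_nonneg (by positivity)]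
    exact hk.2
  · refine IsBigO.of_bound 4 ?_
    filter_upwards [hR] with k hk
    rw [Real.norm_of_nonneg (by positivity), Real.norm_of_nonneg (by positivity)]
    linarith [hk.1]
  · filter_upwards [hCG, hR, eventually_ge_atTop 256] with k hk hRk hk256
    refine hk.trans (ENNReal.ofReal_le_ofReal ?_)
    have hL := hlog k hk256
    have hk' : (256 : ℝ) ≤ k := by exact_mod_cast hk256
    set R := (randQueryComplexity (ApInd k) : ℝ)
    have hs : √(k : ℝ) ≤ √((k : ℝ) * Real.logb 2 k) := Real.sqrt_le_sqrt (by nlinarith)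
    have hs16 : 16 ≤ √(k : ℝ) := Real.le_sqrt_of_sq_le (by linarith)
    have hsq : √(k : ℝ) ^ 2 = k := Real.sq_sqrt (by positivity)
    -- R ≥ √k / 4 gives R² ≥ k/16 ≥ √k, as √k ≥ 16. Hence log k ≤ 4 log R, and 400 = 100 · 4.
    have hRs : √(k : ℝ) ≤ R ^ 2 := by nlinarith [hRk.1]
    have hR0 : 0 < R := by linarith [hRk.1]
    have hkR : (k : ℝ) ≤ R ^ 4 := by
      calc (k : ℝ) = √(k : ℝ) ^ 2 := hsq.symm
        _ ≤ (R ^ 2) ^ 2 := by gcongr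
        _ = R ^ 4 := by ring
    have hle : Real.logb 2 k ≤ 4 * Real.logb 2 R := by
      calc Real.logb 2 k ≤ Real.logb 2 (R ^ 4) :=
            Real.logb_le_logb_of_le (by norm_num) (by linarith) hkR
        _ = _ := by rw [Real.logb_pow]; norm_num
    linarith
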